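/- Let $m,n,r,l_1,l_2$ be positive integers with $r\le l_1<m/2$ and $r\le l_2\le n/2-1/r$. For $\varepsilon\ge 0$, an $\varepsilon$-support set of a random matrix $X\in\mathbb R^{m\times n}$ is a nonempty bounded Borel set $S\subseteq\mathbb R^{m\times n}$ with $\Pr[X\in S]\ge 1-\varepsilon$. The Minkowski dimension of $S$ is $\dim_{\mathrm B}(S)=\lim_{\rho\to0}\frac{\log N_S(\rho)}{\log(1/\rho)}$ (provided that the limit inferior and the limit superior agree), where $N_S(\rho)$ is the least number of open balls of radius $\rho$ in the Euclidean norm $\|A\|_2=\sqrt{\operatorname{tr}(A^{\mathsf T}A)}$ that cover $S$. We say that $X$ can be recovered with error probability at most $\varepsilon$ from $k$ measurements if, for Lebesgue almost all $(A_1,\dots,A_k)\in(\mathbb R^{m\times n})^k$, there is a measurable map $g:\mathbb R^k\to\mathbb R^{m\times n}$ with $\Pr\big[g\big(\langle A_1,X\rangle,\dots,\langle A_k,X\rangle\big)\ne X\big]\le\varepsilon$, where $\langle A,X\rangle=\operatorname{tr}(A^{\mathsf T}X)$. Let $X=X_1^{\mathsf T}X_2$, where $X_1\in\mathbb R^{r\times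 m}$ and $X_2\in\mathbb R^{r\times n}$ are independent random matrices such that $X_1$ has $l_1$ columns, and $X_2$ has $l_2$ columns, at positions drawn uniformly at random (a uniformly distributed set of $l_i$ column indices, independent of the entries) which contain i.i.d. entries with a nondegenerate Gaussian distribution $\mathcal N(\mu_i,v_i)$, $\mu_i\in\mathbb R$, $v_i>0$, $i=1,2$, all other columns being zero. Then: (1) $\operatorname{rank}(X)=r$ almost surely. (2) $(l_1+l_2)r<(m+n-r)r-1$. (3) For every $\varepsilon>0$, $X$ has an $\varepsilon$-support set $T$ whose Minkowski dimension exists and satisfies $\dim_{\mathrm B}(T)\le(l_1+l_2)r$. (4) For every $\varepsilon>0$ and every integer $k>(l_1+l_2)r$, $X$ can be recovered with error probability at most $\varepsilon$ from $k$ measurements. In particular, for every $\varepsilon>0$ there is an integer $k<(m+n-r)r$ such that $X$ can be recovered with error probability at most $\varepsilon$ from $k$ measurements. -/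

import Mathlib

open MeasureTheory ProbabilityTheory Filter Topology
open scoped NNReal ENNReal Matrix

noncomputable section

namespace MatrixCompletion

/-- The product σ-algebra, i.e. the Borel σ-algebra, on `ℝ^{m × n}`. -/
instance instMeasurableSpaceMatrix {m n : ℕ} : MeasurableSpace (Matrix (Fin m) (Fin n) ℝ) :=
  inferInstanceAs (MeasurableSpace (Fin m → Fin n → ℝ))

section Norm

/- `ℝ^{m × n}` carries the Euclidean (Frobenius) norm `‖A‖₂ = √⟨A, A⟩`. -/
attribute [local instance] Matrix.frobeniusNormedAddCommGroup

/-- The set `S` can be covered by `k` open Euclidean balls of radius `ρ`. -/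
def CoveredBy {m n : ℕ} (S : Set (Matrix (Fin m) (Fin n) ℝ)) (ρ : ℝ) (k : ℕ) : Prop :=
  ∃ M : Fin k → Matrix (Fin m) (Fin n) ℝ, S ⊆ ⋃ i, Metric.ball (M i) ρ

/-- The covering number `N_S(ρ)`: the least number of open Euclidean balls of radius `ρ`
that cover `S`. -/
def coveringNumber {m n : ℕ} (S : Set (Matrix (Fin m) (Fin n) ℝ)) (ρ : ℝ) : ℕ :=
  sInf {k : ℕ | CoveredBy S ρ k}

/-- The lower Minkowski dimension of a nonempty bounded set. -/
def lowerMinkowskiDim {m n : ℕ} (S : Set (Matrix (Fin m) (Fin n) ℝ)) : EReal :=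
  liminf (fun ρ : ℝ => ((Real.log (coveringNumber S ρ) / Real.log (1 / ρ) : ℝ) : EReal))
    (𝓝[>] 0)

/-- The upper Minkowski dimension of a nonempty bounded set. -/
def upperMinkowskiDim {m n : ℕ} (S : Set (Matrix (Fin m) (Fin n) ℝ)) : EReal :=
  limsup (fun ρ : ℝ => ((Real.log (coveringNumber S ρ) / Real.log (1 / ρ) : ℝ) : EReal))
    (𝓝[>] 0)

/-- The Minkowski dimension of `S` exists and equals `d`. -/
def HasMinkowskiDim {m n : ℕ} (S : Set (Matrix (Fin m) (Fin n) ℝ)) (d : ℝ) : Prop :=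
  lowerMinkowskiDim S = (d : EReal) ∧ upperMinkowskiDim S = (d : EReal)

/-- `S` is an `ε`-support set of the random matrix `X`: a nonempty bounded (Borel) set with
`Pr[X ∈ S] ≥ 1 - ε`. -/
def IsSupportSet {Ω : Type*} [MeasurableSpace Ω] (P : Measure Ω) {m n : ℕ}
    (X : Ω → Matrix (Fin m) (Fin n) ℝ) (ε : ℝ) (S : Set (Matrix (Fin m) (Fin n) ℝ)) : Prop :=
  S.Nonempty ∧ Bornology.IsBounded S ∧ MeasurableSet S ∧ 1 - ε ≤ P.real {ω | X ω ∈ S}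

end Norm

/-- The vector of measurements `(⟨A₁, X⟩, …, ⟨A_k, X⟩)`, where `⟨A, X⟩ = tr(Aᵀ X)`. -/
def measurements {m n k : ℕ} (A : Fin k → Matrix (Fin m) (Fin n) ℝ)
    (X : Matrix (Fin m) (Fin n) ℝ) : Fin k → ℝ :=
  fun i => ((A i)ᵀ * X).trace

/-- The measurable decoder `g` achieves error probability `ε` for the random matrix `X`
measured with the matrices `A₁, …, A_k`. -/
def AchievesError {Ω : Type*} [MeasurableSpace Ω] (P : Measure Ω) {m n k : ℕ}
    (X : Ω → Matrix (Fin m) (Fin n) ℝ) (A : Fin k → Matrix (Fin m) (Fin n) ℝ)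
    (g : (Fin k → ℝ) → Matrix (Fin m) (Fin n) ℝ) (ε : ℝ) : Prop :=
  Measurable g ∧ P.real {ω | g (measurements A (X ω)) ≠ X ω} ≤ ε

/-- `X` can be recovered with error probability at most `ε` from `k` measurements: for
Lebesgue almost all `(A₁, …, A_k)` in `(ℝ^{m × n})^k` some measurable decoder achieves error
probability `ε`. -/
def RecoverableFrom {Ω : Type*} [MeasurableSpace Ω] (P : Measure Ω) {m n : ℕ}
    (X : Ω → Matrix (Fin m) (Fin n) ℝ) (ε : ℝ) (k : ℕ) : Prop :=
  ∀ᵐ A : Fin k → Fin m → Fin n → ℝ, ∃ g : (Fin k → ℝ) → Matrix (Fin m) (Fin n) ℝ,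
    AchievesError P X (fun i => Matrix.of (A i)) g ε

/-- Keep the columns of `G` with index in `I` and set all other columns to zero. -/
def keepColumns {r m : ℕ} (I : Finset (Fin m)) (G : Fin r → Fin m → ℝ) :
    Matrix (Fin r) (Fin m) ℝ :=
  Matrix.of fun i j => if j ∈ I then G i j else 0

/-- The law of a random `r × m` matrix that has `l` columns, at positions drawn uniformly at
random among the `l`-element sets of positions, with i.i.d. `N(μ, v)` entries, all other
columns being zero: the uniform mixture, over the sets `I` of `l` positions, of the law of an
i.i.d. Gaussian matrix whose columns outside `I` are replaced by zero. -/
def sparseColumnGaussian (r m l : ℕ) (μ : ℝ) (v : ℝ≥0) : Measure (Matrix (Fin r) (Fin m) ℝ) :=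
  ((m.choose l : ℝ≥0∞))⁻¹ • ∑ I ∈ Finset.powersetCard l (Finset.univ : Finset (Fin m)),
    (Measure.pi fun _ : Fin r => Measure.pi fun _ : Fin m => gaussianReal μ v).map
      (keepColumns I)

end MatrixCompletion

end

open MatrixCompletion

namespace MatrixCompletion

/-! Almost surely the first `r` selected columns of each factor form an invertible block: the
Gaussian law is absolutely continuous and a determinant vanishes only on a null set. This gives rank
`r`. Replacing `(M, N)` by `(U⁻¹ M, Uᵀ N)`, with `U` the block of `M`, does not change `Mᵀ N`. Hence
`X` almost surely lies in a finite union of images of the polynomial maps `lowRank a b` in `d = (l₁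
+ l₂) r - r²` variables.

Recovery (`volume_ambiguous_eq_zero`, `recoverableFrom_of_ae_mem_range`): for fixed `x`, the
measurement matrices that confuse `x` with another point of the images form a null set once `k > d`.
By Fubini, almost every `A` is injective on a Borel set of full measure, and the inverse there is
measurable.

Dimension (`hasMinkowskiDim_cubeImages`): the support set is the union of the images of a large
cube. Lipschitz bounds give at most `C ρ⁻ᵈ` covering balls; `d` suitable entries that fill a ball of
`ℝᵈ` force at least `c ρ⁻ᵈ`. So the dimension is exactly `d`. -/

/-! ### Generic invertibility of Gaussian blocks -/

theorem absolutelyContinuous_pi_fin {n : ℕ} {α : Fin n → Type*} [∀ i, MeasurableSpace (α i)]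
    {μ ν : ∀ i, Measure (α i)} [∀ i, SigmaFinite (μ i)] [∀ i, SigmaFinite (ν i)]
    (h : ∀ i, μ i ≪ ν i) : Measure.pi μ ≪ Measure.pi ν := by
  induction n with
  | zero =>
    have : Measure.pi μ = Measure.pi ν := by
      rw [Measure.pi_of_empty μ, Measure.pi_of_empty ν]
    rw [this]
  | succ n ih =>
    rw [← ((measurePreserving_piFinSuccAbove μ 0).symm _).map_eq,
      ← ((measurePreserving_piFinSuccAbove ν 0).symm _).map_eq]
    exact ((h 0).prod (ih fun i => h _)).map (MeasurableEquiv.measurable _)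

theorem gaussian_matrix_absolutelyContinuous (r m : ℕ) (μ : ℝ) {v : ℝ≥0} (hv : v ≠ 0) :
    (Measure.pi fun _ : Fin r => Measure.pi fun _ : Fin m => gaussianReal μ v) ≪
      (volume : Measure (Fin r → Fin m → ℝ)) :=
  absolutelyContinuous_pi_fin fun _ => absolutelyContinuous_pi_fin fun _ =>
    gaussianReal_absolutelyContinuous μ hv

/-- A square block of a matrix is invertible for almost every matrix. -/
theorem ae_det_block_ne_zero {r m : ℕ} (a : Fin r ↪ Fin m) :
    ∀ᵐ G : Fin r → Fin m → ℝ, ((Matrix.of G).submatrix id a).det ≠ 0 := by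
  let E : Fin r → Fin m → ℝ := fun s i => if a s = i then 1 else 0
  let s : Set (Fin r → Fin m → ℝ) := {G | ((Matrix.of G).submatrix id a).det ≠ 0}
  have hcont : Continuous fun G : Fin r → Fin m → ℝ => ((Matrix.of G).submatrix id a).det := by
    refine Continuous.matrix_det ?_
    refine continuous_matrix fun i j => ?_
    simp only [Matrix.submatrix_apply, Matrix.of_apply]
    fun_prop
  have hs : MeasurableSet s := (hcont.measurable (measurableSet_singleton 0)).compl
  -- It suffices to treat each line `G + t E`. Along it the block is `B + t • 1`, whose determinant
  -- is a monic polynomial in `t`.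
  refine ae_mem_of_ae_add_linearMap_mem (LinearMap.toSpanSingleton ℝ _ E) volume volume hs ?_
  intro G
  let B : Matrix (Fin r) (Fin r) ℝ := (Matrix.of G).submatrix id a
  have key : ∀ t : ℝ, ((Matrix.of (G + t • E)).submatrix id a).det = (-B).charpoly.eval t := by
    intro t
    rw [Matrix.eval_charpoly]
    congr 1
    ext i j
    by_cases hij : i = j
    · subst hij; simp [B, E]; ring
    · simp [B, E, hij]
  have hfin : {t : ℝ | (-B).charpoly.IsRoot t}.Finite :=
    Polynomial.finite_setOfPred_isRoot (Matrix.charpoly_monic _).ne_zero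
  rw [ae_iff]
  refine measure_mono_null ?_ (hfin.measure_zero volume)
  intro t ht
  have ht' : ((Matrix.of (G + t • E)).submatrix id a).det = 0 := not_not.1 ht
  rw [key] at ht'
  exact ht'

/-- The matrix that places a column with index `c` at position `a c`. -/
def columnEmbedding {m : ℕ} {κ : Type*} (a : κ ↪ Fin m) : Matrix κ (Fin m) ℝ :=
  Matrix.of fun c i => if a c = i then 1 else 0

/-- Place the columns of `M` at the positions `a`, all other columns being zero. -/
def spread {m : ℕ} {ρ κ : Type*} [Fintype κ] (a : κ ↪ Fin m) (M : Matrix ρ κ ℝ) :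
    Matrix ρ (Fin m) ℝ :=
  M * columnEmbedding a

theorem spread_apply {m : ℕ} {ρ κ : Type*} [Fintype κ] (a : κ ↪ Fin m)
    (M : Matrix ρ κ ℝ) (s : ρ) (i : Fin m) :
    spread a M s i = ∑ c, if a c = i then M s c else 0 := by
  simp [spread, columnEmbedding, Matrix.mul_apply]

@[simp]
theorem spread_apply_embedding {m : ℕ} {ρ κ : Type*} [Fintype κ] (a : κ ↪ Fin m)
    (M : Matrix ρ κ ℝ) (s : ρ) (c : κ) : spread a M s (a c) = M s c := by
  classical
  simp [spread_apply]

theorem keepColumns_eq_spread {r m : ℕ} {κ : Type*} [Fintype κ] (a : κ ↪ Fin m)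
    {I : Finset (Fin m)} (ha : ∀ i, i ∈ I ↔ i ∈ Set.range a) (G : Fin r → Fin m → ℝ) :
    keepColumns I G = spread a ((Matrix.of G).submatrix id a) := by
  ext s i
  by_cases hi : i ∈ I
  · obtain ⟨c, rfl⟩ := (ha i).1 hi
    simp [keepColumns, hi]
  · have : ∀ c, a c ≠ i := fun c hc => hi ((ha i).2 ⟨c, hc⟩)
    simp [keepColumns, hi, spread_apply, this]

/-- Almost surely, a sparse-column Gaussian matrix has `r + p` columns outside of which it
vanishes, the first `r` of which form an invertible block. -/
theorem ae_sparseColumnGaussian (r m p : ℕ) (μ : ℝ) {v : ℝ≥0} (hv : v ≠ 0) :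
    ∀ᵐ Y ∂sparseColumnGaussian r m (r + p) μ v, ∃ (a : Fin r ⊕ Fin p ↪ Fin m)
      (M : Matrix (Fin r) (Fin r ⊕ Fin p) ℝ), Y = spread a M ∧ IsUnit M.toCols₁.det := by
  unfold sparseColumnGaussian
  refine Measure.ae_smul_measure ?_ _
  rw [ae_finsetSum_measure_iff]
  intro I hI
  have hcard : Fintype.card (Fin r ⊕ Fin p) = Fintype.card I := by
    simp [(Finset.mem_powersetCard.1 hI).2]
  let e : Fin r ⊕ Fin p ≃ I := Fintype.equivOfCardEq hcard
  let a : Fin r ⊕ Fin p ↪ Fin m := e.toEmbedding.trans (Function.Embedding.subtype _)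
  have ha : ∀ i, i ∈ I ↔ i ∈ Set.range a := by
    intro i
    constructor
    · intro hi
      exact ⟨e.symm ⟨i, hi⟩, by simp [a]⟩
    · rintro ⟨c, rfl⟩
      exact (e c).2
  have hmeas : Measurable (keepColumns I : (Fin r → Fin m → ℝ) → Matrix (Fin r) (Fin m) ℝ) := by
    refine measurable_pi_iff.2 fun s => measurable_pi_iff.2 fun i => ?_
    by_cases hi : i ∈ I
    · simp only [keepColumns, Matrix.of_apply, hi, if_true]; fun_prop
    · simp only [keepColumns, Matrix.of_apply, hi, if_false]; fun_prop
  let b : Fin r ↪ Fin m := Function.Embedding.inl.trans a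
  have hdet : Measurable fun Y : Matrix (Fin r) (Fin m) ℝ => (Y.submatrix id b).det := by
    have : Continuous fun Y : Fin r → Fin m → ℝ => ((Matrix.of Y).submatrix id b).det := by
      refine Continuous.matrix_det ?_
      refine continuous_matrix fun i j => ?_
      simp only [Matrix.submatrix_apply, Matrix.of_apply]
      fun_prop
    exact this.measurable
  have hfix : MeasurableSet {Y : Fin r → Fin m → ℝ | keepColumns I Y = Y} := by
    let f : (Fin r → Fin m → ℝ) → Fin r → Fin m → ℝ := keepColumns I
    have hf : Measurable f := hmeas
    have h : MeasurableSet {Y | f Y = Y} := measurableSet_eq_fun hf measurable_id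
    exact h
  -- The existential claim is replaced by a visibly measurable condition, as `ae_map_iff` requires.
  have hae : ∀ᵐ Y : Matrix (Fin r) (Fin m) ℝ ∂((Measure.pi fun _ : Fin r => Measure.pi fun _ : Fin m =>
      gaussianReal μ v).map (keepColumns I)),
      keepColumns I Y = Y ∧ (Y.submatrix id b).det ≠ 0 := by
    rw [ae_map_iff hmeas.aemeasurable]
    · filter_upwards [(gaussian_matrix_absolutelyContinuous r m μ hv).ae_le
        (ae_det_block_ne_zero b)] with G hG
      constructor
      · ext s i
        by_cases hi : i ∈ I <;> simp [keepColumns, hi]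
      · rw [keepColumns_eq_spread a ha]
        convert hG using 2
        ext s c
        simp [b]
    · exact hfix.inter
        (hdet (measurableSet_singleton 0)).compl
  filter_upwards [hae] with Y hY
  refine ⟨a, Y.submatrix id a, ?_, ?_⟩
  · exact hY.1.symm.trans (keepColumns_eq_spread a ha Y)
  · exact isUnit_iff_ne_zero.2 hY.2

/-! ### Normalized coordinates, rank and dimension count -/

/-- The coordinates of a rank-`r` matrix with `r + p` nonzero rows and `r + q` nonzero columns. -/
abbrev Params (r p q : ℕ) : Type := (Fin r × (Fin r ⊕ Fin q)) ⊕ (Fin r × Fin p)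

/-- The factor `[1 A]`. -/
def leftFactor {r p q : ℕ} (t : Params r p q → ℝ) : Matrix (Fin r) (Fin r ⊕ Fin p) ℝ :=
  Matrix.fromCols 1 (Matrix.of fun s c => t (Sum.inr (s, c)))

/-- The unrestricted factor. -/
def rightFactor {r p q : ℕ} (t : Params r p q → ℝ) : Matrix (Fin r) (Fin r ⊕ Fin q) ℝ :=
  Matrix.of fun s c => t (Sum.inl (s, c))

/-- The matrix of rank at most `r` with rows in the range of `a` and columns in the range of `b`
that has coordinates `t`. -/
def lowRank {m n r p q : ℕ} (a : Fin r ⊕ Fin p ↪ Fin m) (b : Fin r ⊕ Fin q ↪ Fin n)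
    (t : Params r p q → ℝ) : Matrix (Fin m) (Fin n) ℝ :=
  (spread a (leftFactor t))ᵀ * spread b (rightFactor t)

/-- The action `(U⁻¹ M, Uᵀ N)` of `GL_r` preserves the product; it is spent on turning the first
block of `M` into `1`, which saves `r²` coordinates. -/
theorem exists_lowRank_eq {m n r p q : ℕ} (a : Fin r ⊕ Fin p ↪ Fin m)
    (b : Fin r ⊕ Fin q ↪ Fin n) (M : Matrix (Fin r) (Fin r ⊕ Fin p) ℝ)
    (N : Matrix (Fin r) (Fin r ⊕ Fin q) ℝ) (hM : IsUnit M.toCols₁.det) :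
    ∃ t, (spread a M)ᵀ * spread b N = lowRank a b t := by
  let U := M.toCols₁
  let t : Params r p q → ℝ := Sum.elim (fun x => (Uᵀ * N) x.1 x.2)
    fun x => (U⁻¹ * M.toCols₂) x.1 x.2
  have hl : leftFactor t = U⁻¹ * M := by
    conv_rhs => rw [← Matrix.fromCols_toCols M, Matrix.mul_fromCols,
      Matrix.nonsing_inv_mul _ hM]
    rfl
  have hr : rightFactor t = Uᵀ * N := rfl
  refine ⟨t, ?_⟩
  rw [lowRank, hl, hr]
  have hU : (U⁻¹)ᵀ * Uᵀ = 1 := by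
    rw [← Matrix.transpose_mul, Matrix.mul_nonsing_inv _ hM, Matrix.transpose_one]
  simp only [spread, Matrix.transpose_mul, Matrix.mul_assoc]
  rw [← Matrix.mul_assoc (U⁻¹)ᵀ, hU, Matrix.one_mul]

theorem rank_spread_mul_spread {m n r p q : ℕ} (a : Fin r ⊕ Fin p ↪ Fin m)
    (b : Fin r ⊕ Fin q ↪ Fin n) (M : Matrix (Fin r) (Fin r ⊕ Fin p) ℝ)
    (N : Matrix (Fin r) (Fin r ⊕ Fin q) ℝ) (hM : IsUnit M.toCols₁.det)
    (hN : IsUnit N.toCols₁.det) : ((spread a M)ᵀ * spread b N).rank = r := by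
  apply le_antisymm
  · refine (Matrix.rank_mul_le_right _ _).trans ?_
    exact (Matrix.rank_le_card_height _).trans_eq (Fintype.card_fin r)
  · have h : ((spread a M)ᵀ * spread b N).submatrix (a ∘ Sum.inl) (b ∘ Sum.inl) =
        M.toCols₁ᵀ * N.toCols₁ := by
      ext i j
      simp [Matrix.mul_apply, Matrix.toCols₁]
    have hr : (M.toCols₁ᵀ * N.toCols₁).rank = r := by
      rw [Matrix.rank_of_isUnit, Fintype.card_fin]
      rw [Matrix.isUnit_iff_isUnit_det, Matrix.det_mul, Matrix.det_transpose]
      exact hM.mul hN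
    calc r = _ := hr.symm
      _ ≤ _ := by rw [← h]; exact Matrix.rank_submatrix_le _ _ _

/-- The upper bounds give `(m + n) r > 2 (l₁ + l₂) r + 2`, and `(l₁ + l₂) r ≥ 2 r²` absorbs the loss
of `r²`. -/
theorem dimension_count {m n r l₁ l₂ : ℕ} (hr : 1 ≤ r)
    (hrl₁ : r ≤ l₁) (hl₁ : (l₁ : ℝ) < m / 2)
    (hrl₂ : r ≤ l₂) (hl₂ : (l₂ : ℝ) ≤ n / 2 - 1 / r) :
    (l₁ + l₂ : ℝ) * r < (m + n - r : ℝ) * r - 1 := by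
  have hr' : (1 : ℝ) ≤ r := by exact_mod_cast hr
  have h1 : (r : ℝ) ≤ l₁ := by exact_mod_cast hrl₁
  have h2 : (r : ℝ) ≤ l₂ := by exact_mod_cast hrl₂
  have h3 : (1 : ℝ) / r * r = 1 := by field_simp
  nlinarith

/-! ### Ambiguous measurements and recovery -/

theorem volume_eq_zero_of_dimH_lt {E : Type*} [NormedAddCommGroup E] [NormedSpace ℝ E]
    [FiniteDimensional ℝ E] [MeasureSpace E] [BorelSpace E]
    [(volume : Measure E).IsAddHaarMeasure] {s : Set E}
    (hs : dimH s < Module.finrank ℝ E) : volume s = 0 := by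
  have h : Measure.hausdorffMeasure (Module.finrank ℝ E : ℝ) s = 0 :=
    hausdorffMeasure_of_dimH_lt (d := Module.finrank ℝ E) (by exact_mod_cast hs)
  exact Measure.absolutelyContinuous_isAddHaarMeasure volume
    (Measure.hausdorffMeasure (Module.finrank ℝ E : ℝ)) h

/-- The image of a space of smaller dimension under a map that is `C¹` near a set is null. -/
theorem volume_image_eq_zero {E F : Type*} [NormedAddCommGroup E] [NormedSpace ℝ E]
    [FiniteDimensional ℝ E] [NormedAddCommGroup F] [NormedSpace ℝ F]
    [FiniteDimensional ℝ F] [MeasureSpace F] [BorelSpace F]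
    [(volume : Measure F).IsAddHaarMeasure] {f : E → F} {s : Set E}
    (hf : ∀ x ∈ s, ContDiffAt ℝ 1 f x) (h : Module.finrank ℝ E < Module.finrank ℝ F) :
    volume (f '' s) = 0 := by
  apply volume_eq_zero_of_dimH_lt
  have : dimH (f '' s) ≤ dimH s := by
    refine dimH_image_le_of_locally_lipschitzOn fun x hx => ?_
    obtain ⟨K, t, ht, hK⟩ := (hf x hx).exists_lipschitzOnWith
    exact ⟨K, t, mem_nhdsWithin_of_mem_nhds ht, hK⟩
  refine (this.trans (dimH_mono (Set.subset_univ s))).trans_lt ?_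
  rw [Real.dimH_univ_eq_finrank]
  exact_mod_cast h

/-- The measurements of the difference of the points with coordinates `t` and `x` vanish. -/
def Ambiguous {T : Type*} {m n k : ℕ} (F : T → Fin m → Fin n → ℝ)
    (A : Fin k → Fin m → Fin n → ℝ) (x : Fin m → Fin n → ℝ) : Prop :=
  ∃ t, F t ≠ x ∧ ∀ l, ∑ p : Fin m × Fin n, A l p.1 p.2 * (F t p.1 p.2 - x p.1 p.2) = 0

/-- If `F t` and `x` differ at the entry `p`, each of the `k` equations determines `A l` at `p` from
`t` and the other entries. So the bad `A` are covered by images of spaces of too small a dimension.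
-/
theorem volume_ambiguous_eq_zero {ι : Type*} [Fintype ι] {m n k : ℕ}
    (hk : Fintype.card ι < k) {F : (ι → ℝ) → Fin m → Fin n → ℝ} (hF : ContDiff ℝ 1 F)
    (x : Fin m → Fin n → ℝ) :
    volume {A : Fin k → Fin m → Fin n → ℝ | Ambiguous F A x} = 0 := by
  classical
  let Φ (p : Fin m × Fin n) (z : (ι → ℝ) × (Fin k → {q : Fin m × Fin n // q ≠ p} → ℝ)) :
      Fin k → Fin m → Fin n → ℝ := fun l i j =>
    if h : (i, j) = p then
      -(∑ q : {q : Fin m × Fin n // q ≠ p}, z.2 l q * (F z.1 q.1.1 q.1.2 - x q.1.1 q.1.2)) /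
        (F z.1 p.1 p.2 - x p.1 p.2)
    else z.2 l ⟨(i, j), h⟩
  have hsub : {A : Fin k → Fin m → Fin n → ℝ | Ambiguous F A x} ⊆
      ⋃ p, Φ p '' {z | F z.1 p.1 p.2 - x p.1 p.2 ≠ 0} := by
    rintro A ⟨t, htx, hA⟩
    obtain ⟨i, hi⟩ := Function.ne_iff.1 htx
    obtain ⟨j, hj⟩ := Function.ne_iff.1 hi
    have hne : F t i j - x i j ≠ 0 := sub_ne_zero.2 hj
    refine Set.mem_iUnion.2 ⟨(i, j), (t, fun l q => A l q.1.1 q.1.2), hne, ?_⟩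
    ext l i' j'
    by_cases h : (i', j') = (i, j)
    · obtain ⟨rfl, rfl⟩ := Prod.mk.inj h
      have := hA l
      rw [Fintype.sum_eq_add_sum_subtype_ne _ (i', j')] at this
      simp only [Φ, dif_pos]
      rw [div_eq_iff hne]
      linarith
    · simp only [Φ, dif_neg h]
  refine measure_mono_null hsub (measure_iUnion_null fun p => ?_)
  have hV₂ : (volume : Measure (Fin m → Fin n → ℝ)).IsAddHaarMeasure :=
    Measure.pi.isAddHaarMeasure (fun _ : Fin m => (volume : Measure (Fin n → ℝ)))
  have hV₃ : (volume : Measure (Fin k → Fin m → Fin n → ℝ)).IsAddHaarMeasure :=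
    Measure.pi.isAddHaarMeasure (fun _ : Fin k => (volume : Measure (Fin m → Fin n → ℝ)))
  refine volume_image_eq_zero (fun z hz => ?_) ?_
  · have hFe : ∀ i j, ContDiff ℝ 1 fun t => F t i j := fun i j =>
      contDiff_pi.1 (contDiff_pi.1 hF i) j
    have hFz : ∀ i j, ContDiffAt ℝ 1
        (fun z : (ι → ℝ) × (Fin k → {q : Fin m × Fin n // q ≠ p} → ℝ) =>
          F z.1 i j - x i j) z := fun i j =>
      (((hFe i j).comp contDiff_fst).sub contDiff_const).contDiffAt
    have hz2 : ∀ l q, ContDiffAt ℝ 1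
        (fun z : (ι → ℝ) × (Fin k → {q : Fin m × Fin n // q ≠ p} → ℝ) => z.2 l q) z := by
      intro l q
      fun_prop
    refine contDiffAt_pi.2 fun l => contDiffAt_pi.2 fun i => contDiffAt_pi.2 fun j => ?_
    by_cases h : (i, j) = p
    · simp only [Φ, h, dif_pos]
      refine ContDiffAt.div (ContDiffAt.neg (ContDiffAt.sum fun q _ => ?_)) (hFz _ _) hz
      exact (hz2 l q).mul (hFz _ _)
    · simp only [Φ, h, dif_neg, not_false_eq_true]
      exact hz2 _ _
  · have hcard : Fintype.card {q : Fin m × Fin n // q ≠ p} + 1 = m * n := by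
      have h1 := Fintype.card_subtype_compl (fun q : Fin m × Fin n => q = p)
      have h2 : 0 < Fintype.card (Fin m × Fin n) := Fintype.card_pos_iff.2 ⟨p⟩
      simp only [Fintype.card_unique, Fintype.card_prod, Fintype.card_fin] at h1 h2
      simp only [ne_eq, h1]
      omega
    simp only [Module.finrank_prod, Module.finrank_pi_fintype, Module.finrank_self,
      Finset.sum_const, Finset.card_univ, smul_eq_mul, mul_one, Fintype.card_fin]
    -- The source has dimension `|ι| + k (m n - 1)`, the target `k m n`; the gap is `k - |ι|`.
    rw [← hcard, mul_add]
    omega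

/-- Needed for Fubini. The condition `F t ≠ x` is exhausted by the closed conditions `‖F t - x‖ ≥ 1
/ (N + 1)`; closed sets here are σ-compact, and so are their projections. -/
theorem measurableSet_ambiguous {ι : Type*} [Fintype ι] {m n k : ℕ}
    {F : (ι → ℝ) → Fin m → Fin n → ℝ} (hF : Continuous F) :
    MeasurableSet {z : (Fin k → Fin m → Fin n → ℝ) × (Fin m → Fin n → ℝ) |
      Ambiguous F z.1 z.2} := by
  let Z (N : ℕ) : Set (((Fin k → Fin m → Fin n → ℝ) × (Fin m → Fin n → ℝ)) × (ι → ℝ)) :=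
    {w | 1 / ((N : ℝ) + 1) ≤ ‖F w.2 - w.1.2‖ ∧ ∀ l, ∑ p : Fin m × Fin n,
      w.1.1 l p.1 p.2 * (F w.2 p.1 p.2 - w.1.2 p.1 p.2) = 0}
  have hZ : ∀ N, IsClosed (Z N) := by
    intro N
    refine IsClosed.and ?_ ?_
    · exact isClosed_le continuous_const (by fun_prop)
    · have h : IsClosed (⋂ l, {w : ((Fin k → Fin m → Fin n → ℝ) × (Fin m → Fin n → ℝ)) ×
          (ι → ℝ) | ∑ p : Fin m × Fin n,
            w.1.1 l p.1 p.2 * (F w.2 p.1 p.2 - w.1.2 p.1 p.2) = 0}) :=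
        isClosed_iInter fun l => isClosed_eq (by fun_prop) continuous_const
      convert h using 1
      ext w
      simp
  have heq : {z : (Fin k → Fin m → Fin n → ℝ) × (Fin m → Fin n → ℝ) | Ambiguous F z.1 z.2} =
      ⋃ N, Prod.fst '' Z N := by
    ext z
    constructor
    · rintro ⟨t, ht, hz⟩
      obtain ⟨N, hN⟩ := exists_nat_one_div_lt (norm_pos_iff.2 (sub_ne_zero.2 ht))
      exact Set.mem_iUnion.2 ⟨N, (z, t), ⟨hN.le, hz⟩, rfl⟩
    · intro hz
      obtain ⟨N, ⟨z, t⟩, ⟨h1, h2⟩, rfl⟩ := Set.mem_iUnion.1 hz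
      refine ⟨t, fun h => ?_, h2⟩
      have : (0 : ℝ) < 1 / ((N : ℝ) + 1) := by positivity
      simp only [h, sub_self, norm_zero] at h1
      exact absurd h1 (not_le.2 this)
  rw [heq]
  refine MeasurableSet.iUnion fun N => ?_
  obtain ⟨K, hK, hKN⟩ := (isSigmaCompact_univ.of_isClosed_subset (hZ N)
    (Set.subset_univ _)).image continuous_fst
  rw [← hKN]
  exact MeasurableSet.iUnion fun i => (hK i).measurableSet

theorem measurableSet_range_of_continuous {ι : Type*} [Fintype ι] {m n : ℕ}
    {F : (ι → ℝ) → Fin m → Fin n → ℝ} (hF : Continuous F) : MeasurableSet (Set.range F) := by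
  obtain ⟨K, hK, hKN⟩ := isSigmaCompact_range hF
  rw [← hKN]
  exact MeasurableSet.iUnion fun i => (hK i).measurableSet

theorem measurements_apply {m n k : ℕ} (A : Fin k → Fin m → Fin n → ℝ)
    (x : Fin m → Fin n → ℝ) (l : Fin k) :
    measurements (fun i => Matrix.of (A i)) x l = ∑ p : Fin m × Fin n, A l p.1 p.2 * x p.1 p.2 := by
  rw [Fintype.sum_prod_type, Finset.sum_comm]
  rfl

/-- A random matrix that almost surely lies in a countable union of `C¹` images of `ℝ^ι` can be
recovered from more than `|ι|` measurements. -/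
theorem recoverableFrom_of_ae_mem_range {Ω : Type*} [MeasurableSpace Ω] (P : Measure Ω)
    [IsProbabilityMeasure P] {ι κ : Type*} [Fintype ι] [Countable κ] {m n k : ℕ}
    (hk : Fintype.card ι < k) {F : κ → (ι → ℝ) → Matrix (Fin m) (Fin n) ℝ}
    (hF : ∀ c, @ContDiff ℝ _ (ι → ℝ) _ _ (Fin m → Fin n → ℝ) _ _ 1 (F c))
    {X : Ω → Matrix (Fin m) (Fin n) ℝ} (hX : AEMeasurable X P)
    (hXF : ∀ᵐ ω ∂P, ∃ c t, X ω = F c t) {ε : ℝ} (hε : 0 ≤ ε) : RecoverableFrom P X ε k := by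
  let F' : κ → (ι → ℝ) → Fin m → Fin n → ℝ := F
  let ν : Measure (Fin m → Fin n → ℝ) := P.map X
  have : IsProbabilityMeasure ν := Measure.isProbabilityMeasure_map hX
  let S : Set (Fin m → Fin n → ℝ) := ⋃ c, Set.range (F' c)
  have hS : MeasurableSet S :=
    MeasurableSet.iUnion fun c => measurableSet_range_of_continuous (hF c).continuous
  let B : Set ((Fin k → Fin m → Fin n → ℝ) × (Fin m → Fin n → ℝ)) :=
    ⋃ c, {z | Ambiguous (F' c) z.1 z.2}
  have hB : MeasurableSet B :=
    MeasurableSet.iUnion fun c => measurableSet_ambiguous (hF c).continuous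
  have hnull : ∀ᵐ A : Fin k → Fin m → Fin n → ℝ, ∀ᵐ x ∂ν, (A, x) ∉ B := by
    have h0 : ∀ᵐ z ∂((volume : Measure (Fin k → Fin m → Fin n → ℝ)).prod ν), z ∉ B := by
      rw [ae_iff]
      simp only [not_not]
      rw [Measure.prod_apply_symm (s := {z | z ∈ B}) hB]
      refine (lintegral_congr fun x => ?_).trans lintegral_zero
      refine measure_mono_null (t := ⋃ c, {A | Ambiguous (F' c) A x}) ?_
        (measure_iUnion_null fun c => volume_ambiguous_eq_zero hk (hF c) x)
      intro A hA
      simpa [B] using hA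
    exact Measure.ae_ae_of_ae_prod h0
  filter_upwards [hnull] with A hA
  let G : Set (Fin m → Fin n → ℝ) := S ∩ {x | (A, x) ∉ B}
  have hG : MeasurableSet G := hS.inter (measurable_prodMk_left hB).compl
  let φ : (Fin m → Fin n → ℝ) → Fin k → ℝ := fun x => measurements (fun i => Matrix.of (A i)) x
  have hφ : Continuous φ := by
    refine continuous_pi fun l => ?_
    simp only [φ, measurements_apply]
    fun_prop
  -- A point `x = F c t` with the same measurements as `y ≠ x` would make `y` ambiguous.
  have hinj : Set.InjOn φ G := by
    rintro x hx y hy hxy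
    obtain ⟨c, t, rfl⟩ := Set.mem_iUnion.1 hx.1
    by_contra hne
    refine hy.2 (Set.mem_iUnion.2 ⟨c, t, hne, fun l => ?_⟩)
    have := congrFun hxy l
    simp only [φ, measurements_apply] at this
    simp only [mul_sub, Finset.sum_sub_distrib]
    exact sub_eq_zero.2 this
  -- Lusin–Souslin: a continuous injection on a Borel set has a measurable inverse, which extends to
  -- the decoder.
  obtain ⟨g, hg, hgφ⟩ := (hφ.continuousOn.measurableEmbedding hG hinj).exists_measurable_extend
    measurable_subtype_coe fun _ => inferInstance
  refine ⟨g, hg, ?_⟩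
  have hXG : ∀ᵐ ω ∂P, g (measurements (fun i => Matrix.of (A i)) (X ω)) = X ω := by
    filter_upwards [hXF, ae_of_ae_map hX hA] with ω h1 h2
    obtain ⟨c, t, hct⟩ := h1
    exact congrFun hgφ ⟨X ω, Set.mem_iUnion.2 ⟨c, t, hct.symm⟩, h2⟩
  have h0 : P.real {ω | g (measurements (fun i => Matrix.of (A i)) (X ω)) ≠ X ω} = 0 := by
    rw [measureReal_def, show P {ω | g (measurements (fun i => Matrix.of (A i)) (X ω)) ≠ X ω} = 0
      from hXG, ENNReal.toReal_zero]
  exact h0.trans_le hε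

/-! ### Covering numbers and Minkowski dimension -/

section Norm

attribute [local instance] Matrix.frobeniusNormedAddCommGroup

theorem frobenius_norm_eq_sqrt {m n : ℕ} (M : Matrix (Fin m) (Fin n) ℝ) :
    ‖M‖ = √(∑ i, ∑ j, M i j ^ 2) := by
  rw [Matrix.frobenius_norm_def, Real.sqrt_eq_rpow]
  simp

theorem abs_entry_le_frobenius_norm {m n : ℕ} (M : Matrix (Fin m) (Fin n) ℝ) (i : Fin m)
    (j : Fin n) : |M i j| ≤ ‖M‖ := by
  rw [frobenius_norm_eq_sqrt]
  apply Real.abs_le_sqrt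
  calc M i j ^ 2 ≤ ∑ j, M i j ^ 2 :=
        Finset.single_le_sum (f := fun j => M i j ^ 2) (fun _ _ => sq_nonneg _)
          (Finset.mem_univ j)
    _ ≤ ∑ i, ∑ j, M i j ^ 2 :=
        Finset.single_le_sum (f := fun i => ∑ j, M i j ^ 2)
          (fun _ _ => Finset.sum_nonneg fun _ _ => sq_nonneg _) (Finset.mem_univ i)

theorem frobenius_norm_le {m n : ℕ} (M : Matrix (Fin m) (Fin n) ℝ) {δ : ℝ} (hδ : 0 ≤ δ)
    (h : ∀ i j, |M i j| ≤ δ) : ‖M‖ ≤ (m * n + 1) * δ := by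
  rw [frobenius_norm_eq_sqrt]
  apply Real.sqrt_le_iff.2 ⟨by positivity, ?_⟩
  have h1 : ∑ i, ∑ j, M i j ^ 2 ≤ ∑ _i : Fin m, ∑ _j : Fin n, δ ^ 2 :=
    Finset.sum_le_sum fun i _ => Finset.sum_le_sum fun j _ => sq_le_sq' (abs_le.1 (h i j)).1
      (abs_le.1 (h i j)).2
  simp only [Finset.sum_const, Finset.card_univ, Fintype.card_fin, nsmul_eq_mul] at h1
  have h2 : (0 : ℝ) ≤ (m : ℝ) * n := by positivity
  nlinarith [sq_nonneg δ, mul_nonneg h2 (sq_nonneg δ), mul_nonneg (mul_nonneg h2 h2) (sq_nonneg δ)]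

theorem coveringNumber_le {m n : ℕ} {S : Set (Matrix (Fin m) (Fin n) ℝ)} {ρ : ℝ} {k : ℕ}
    (h : CoveredBy S ρ k) : coveringNumber S ρ ≤ k := Nat.sInf_le h

/-- Some cover must exist, since `sInf ∅ = 0` would be a spurious minimum. -/
theorem CoveredBy.coveredBy_coveringNumber {m n : ℕ} {S : Set (Matrix (Fin m) (Fin n) ℝ)} {ρ : ℝ}
    {k : ℕ} (h : CoveredBy S ρ k) : CoveredBy S ρ (coveringNumber S ρ) :=
  Nat.sInf_mem (s := {k | CoveredBy S ρ k}) ⟨k, h⟩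

theorem coveredBy_card {m n : ℕ} {S : Set (Matrix (Fin m) (Fin n) ℝ)} {ρ : ℝ} {σ : Type*}
    [Fintype σ] (M : σ → Matrix (Fin m) (Fin n) ℝ) (h : ∀ x ∈ S, ∃ s, ‖x - M s‖ < ρ) :
    CoveredBy S ρ (Fintype.card σ) := by
  refine ⟨fun i => M ((Fintype.equivFin σ).symm i), fun x hx => ?_⟩
  obtain ⟨s, hs⟩ := h x hx
  exact Set.mem_iUnion.2 ⟨Fintype.equivFin σ s, by simpa [dist_eq_norm] using hs⟩

/-- If a coordinate projection of `S` to `ℝ^ι` contains a ball of radius `δ`, then a cover of `S`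
by balls of radius `ρ` has at least `(δ / ρ) ^ |ι|` members. -/
theorem CoveredBy.le_card {m n : ℕ} {S : Set (Matrix (Fin m) (Fin n) ℝ)} {ρ : ℝ} {k : ℕ}
    (h : CoveredBy S ρ k) (hρ : 0 < ρ) {ι : Type*} [Fintype ι] (e : ι → Fin m × Fin n)
    (y₀ : ι → ℝ) {δ : ℝ} (hδ : 0 < δ)
    (hS : ∀ y ∈ Metric.ball y₀ δ, ∃ M ∈ S, ∀ i, M (e i).1 (e i).2 = y i) :
    (δ / ρ) ^ Fintype.card ι ≤ k := by
  obtain ⟨M, hM⟩ := h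
  let c : Fin k → ι → ℝ := fun l i => M l (e i).1 (e i).2
  -- Reading off entries is 1-Lipschitz from the Frobenius to the sup norm, so the cover projects to
  -- a cover by cubes, whose volumes are then compared.
  have hsub : Metric.ball y₀ δ ⊆ ⋃ l, Metric.ball (c l) ρ := by
    intro y hy
    obtain ⟨N, hN, hNy⟩ := hS y hy
    obtain ⟨l, hl⟩ := Set.mem_iUnion.1 (hM hN)
    refine Set.mem_iUnion.2 ⟨l, ?_⟩
    rw [Metric.mem_ball, dist_pi_lt_iff hρ]
    intro i
    rw [Metric.mem_ball, dist_eq_norm] at hl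
    refine lt_of_le_of_lt ?_ hl
    rw [← hNy i, Real.dist_eq]
    exact abs_entry_le_frobenius_norm (N - M l) (e i).1 (e i).2
  have hvol : ENNReal.ofReal ((2 * δ) ^ Fintype.card ι) ≤
      ENNReal.ofReal (k * (2 * ρ) ^ Fintype.card ι) := by
    calc ENNReal.ofReal ((2 * δ) ^ Fintype.card ι) = volume (Metric.ball y₀ δ) :=
          (Real.volume_pi_ball y₀ hδ).symm
      _ ≤ volume (⋃ l, Metric.ball (c l) ρ) := measure_mono hsub
      _ ≤ ∑ l, volume (Metric.ball (c l) ρ) := measure_iUnion_fintype_le _ _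
      _ = ENNReal.ofReal (k * (2 * ρ) ^ Fintype.card ι) := by
          simp_rw [Real.volume_pi_ball _ hρ]
          rw [Finset.sum_const, Finset.card_univ, Fintype.card_fin, nsmul_eq_mul,
            ENNReal.ofReal_mul (by positivity), ENNReal.ofReal_natCast]
  rw [ENNReal.ofReal_le_ofReal_iff (by positivity), mul_pow, mul_pow] at hvol
  rw [div_pow, div_le_iff₀ (by positivity)]
  have h2 : (0 : ℝ) < 2 ^ Fintype.card ι := by positivity
  nlinarith

end Norm

/-- Covering numbers that are comparable to `ρ ^ (-d)` yield Minkowski dimension `d`. -/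
theorem hasMinkowskiDim_of_bounds {m n : ℕ} {S : Set (Matrix (Fin m) (Fin n) ℝ)} {d : ℕ}
    {c C : ℝ} (hc : 0 < c) (hC : 0 < C)
    (h : ∀ᶠ ρ : ℝ in 𝓝[>] 0, c * (1 / ρ) ^ d ≤ coveringNumber S ρ ∧
      coveringNumber S ρ ≤ C * (1 / ρ) ^ d) : HasMinkowskiDim S d := by
  have hL : Tendsto (fun ρ : ℝ => Real.log (1 / ρ)) (𝓝[>] 0) atTop := by
    simp only [one_div]
    exact Real.tendsto_log_atTop.comp tendsto_inv_nhdsGT_zero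
  have hlim : ∀ b : ℝ, Tendsto (fun ρ : ℝ => Real.log b / Real.log (1 / ρ) + d) (𝓝[>] 0)
      (𝓝 d) := by
    intro b
    simpa using (hL.const_div_atTop (Real.log b)).add_const (d : ℝ)
  have hlog : ∀ b ρ : ℝ, 0 < b → 0 < ρ → Real.log (1 / ρ) ≠ 0 →
      Real.log (b * (1 / ρ) ^ d) / Real.log (1 / ρ) = Real.log b / Real.log (1 / ρ) + d := by
    intro b ρ hb hρ hne
    rw [Real.log_mul hb.ne' (by positivity), Real.log_pow, add_div, mul_div_cancel_right₀ _ hne]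
  have hpos : ∀ᶠ ρ : ℝ in 𝓝[>] 0, 0 < ρ := eventually_mem_nhdsWithin
  have hT : Tendsto (fun ρ : ℝ => Real.log (coveringNumber S ρ) / Real.log (1 / ρ)) (𝓝[>] 0)
      (𝓝 d) := by
    refine tendsto_of_tendsto_of_tendsto_of_le_of_le' (hlim c) (hlim C) ?_ ?_
    · filter_upwards [h, hpos, hL.eventually_gt_atTop 0] with ρ h1 hρ h2
      rw [← hlog c ρ hc hρ h2.ne']
      gcongr
      exact h1.1
    · filter_upwards [h, hpos, hL.eventually_gt_atTop 0] with ρ h1 hρ h2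
      rw [← hlog C ρ hC hρ h2.ne']
      have h3 : (0 : ℝ) < coveringNumber S ρ := lt_of_lt_of_le (by positivity) h1.1
      gcongr
      exact h1.2
  have hE := (continuous_coe_real_ereal.tendsto (d : ℝ)).comp hT
  exact ⟨hE.liminf_eq, hE.limsup_eq⟩

/-- The points of the regular grid that divides each side of `[-R, R]^ι` into `N` parts. -/
noncomputable def gridPoint {ι : Type*} (R : ℝ) (N : ℕ) (g : ι → Fin (N + 1)) : ι → ℝ :=
  fun i => -R + 2 * R * (g i : ℕ) / N

theorem gridPoint_mem_Icc {ι : Type*} {R : ℝ} (hR : 0 < R) {N : ℕ} (hN : 0 < N)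
    (g : ι → Fin (N + 1)) : gridPoint R N g ∈ Set.Icc (fun _ => -R) (fun _ => R) := by
  have hN' : (0 : ℝ) < N := by exact_mod_cast hN
  refine ⟨fun i => ?_, fun i => ?_⟩
  · have : 0 ≤ 2 * R * (g i : ℕ) / N := by positivity
    simp only [gridPoint]; linarith
  · have h1 : ((g i : ℕ) : ℝ) ≤ N := by exact_mod_cast Nat.lt_succ_iff.1 (g i).2
    have : 2 * R * (g i : ℕ) / N ≤ 2 * R := by
      rw [div_le_iff₀ hN']
      gcongr
    simp only [gridPoint]; linarith

theorem exists_gridPoint_close {ι : Type*} [Fintype ι] {R : ℝ} (hR : 0 < R) {N : ℕ} (hN : 0 < N)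
    {t : ι → ℝ} (ht : t ∈ Set.Icc (fun _ => -R) (fun _ => R)) :
    ∃ g : ι → Fin (N + 1), dist t (gridPoint R N g) ≤ 2 * R / N := by
  have hN' : (0 : ℝ) < N := by exact_mod_cast hN
  have hnn : ∀ i, 0 ≤ (t i + R) * N / (2 * R) := fun i => by
    have : 0 ≤ t i + R := by linarith [ht.1 i]
    positivity
  have hle : ∀ i, ⌊(t i + R) * N / (2 * R)⌋₊ < N + 1 := fun i => by
    rw [Nat.lt_succ_iff]
    apply Nat.floor_le_of_le
    rw [div_le_iff₀ (by positivity)]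
    nlinarith [ht.2 i]
  refine ⟨fun i => ⟨_, hle i⟩, (dist_pi_le_iff (by positivity)).2 fun i => ?_⟩
  have h1 := Nat.floor_le (hnn i)
  have h2 := Nat.lt_floor_add_one ((t i + R) * N / (2 * R))
  set j : ℝ := (⌊(t i + R) * N / (2 * R)⌋₊ : ℝ)
  -- Each coordinate is rounded down: the error is the mesh times a fractional part.
  have h3 : t i - (-R + 2 * R * j / N) = 2 * R / N * ((t i + R) * N / (2 * R) - j) := by
    field_simp
    ring
  simp only [gridPoint, Real.dist_eq]
  rw [h3, abs_mul, abs_of_pos (by positivity)]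
  refine mul_le_of_le_one_right (by positivity) (abs_le.2 ⟨by linarith, by linarith⟩)

/-! ### Images of cubes as support sets -/

section Norm

attribute [local instance] Matrix.frobeniusNormedAddCommGroup

/-- The union of the images of the cube `[-R, R]^ι`. -/
def cubeImages {ι κ : Type*} {m n : ℕ} (F : κ → (ι → ℝ) → Matrix (Fin m) (Fin n) ℝ) (R : ℝ) :
    Set (Matrix (Fin m) (Fin n) ℝ) :=
  ⋃ c, F c '' Set.Icc (fun _ => -R) (fun _ => R)

theorem exists_coveredBy_cubeImages {ι κ : Type*} [Fintype ι] [Fintype κ] {m n : ℕ}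
    {F : κ → (ι → ℝ) → Matrix (Fin m) (Fin n) ℝ}
    (hF : ∀ c, @ContDiff ℝ _ (ι → ℝ) _ _ (Fin m → Fin n → ℝ) _ _ 1 (F c)) {R : ℝ} (hR : 0 < R) :
    ∃ C : ℝ, 0 < C ∧ ∀ ρ : ℝ, 0 < ρ → ρ ≤ 1 →
      ∃ k : ℕ, CoveredBy (cubeImages F R) ρ k ∧ (k : ℝ) ≤ C * (1 / ρ) ^ Fintype.card ι := by
  classical
  have hLip : ∀ c, ∃ K : ℝ≥0, ∀ t ∈ Set.Icc (fun _ : ι => -R) (fun _ => R),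
      ∀ t' ∈ Set.Icc (fun _ : ι => -R) (fun _ => R),
      ∀ i j, |F c t i j - F c t' i j| ≤ K * dist t t' := by
    intro c
    obtain ⟨K, hK⟩ := (hF c).contDiffOn.exists_lipschitzOnWith one_ne_zero
      (convex_Icc (fun _ : ι => -R) (fun _ => R)) isCompact_Icc
    refine ⟨K, fun t ht t' ht' i j => ?_⟩
    let f : (ι → ℝ) → Fin m → Fin n → ℝ := F c
    calc |F c t i j - F c t' i j| = dist (f t i j) (f t' i j) := (Real.dist_eq _ _).symm
      _ ≤ dist (f t) (f t') := (dist_le_pi_dist _ _ j).trans (dist_le_pi_dist _ _ i)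
      _ ≤ K * dist t t' := hK.dist_le_mul t ht t' ht'
  choose K hK using hLip
  let L : ℝ := ∑ c, (K c : ℝ)
  have hL0 : 0 ≤ L := Finset.sum_nonneg fun c _ => (K c).2
  have hKL : ∀ c, (K c : ℝ) ≤ L := fun c =>
    Finset.single_le_sum (f := fun c => (K c : ℝ)) (fun c _ => (K c).2) (Finset.mem_univ c)
  -- A mesh of `2 R / N` moves each entry by at most `L (2 R / N)`, hence the matrix by at most `D /
  -- N` in norm.
  let D : ℝ := (m * n + 1) * (L * (2 * R))
  have hD : 0 ≤ D := by positivity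
  refine ⟨(Fintype.card κ + 1) * (D + 2) ^ Fintype.card ι, by positivity, fun ρ hρ hρ1 => ?_⟩
  -- The `+ 1` makes `D / N < ρ` strict, as open balls require.
  let N : ℕ := ⌊D / ρ⌋₊ + 1
  have hN : 0 < N := Nat.succ_pos _
  have hN' : (0 : ℝ) < N := by exact_mod_cast hN
  have hDN : D / N < ρ := by
    rw [div_lt_iff₀ hN', mul_comm, ← div_lt_iff₀ hρ]
    exact_mod_cast Nat.lt_floor_add_one (D / ρ)
  have hNle : (N : ℝ) + 1 ≤ (D + 2) * (1 / ρ) := by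
    have h1 : (⌊D / ρ⌋₊ : ℝ) ≤ D / ρ := Nat.floor_le (by positivity)
    have h2 : 1 ≤ 1 / ρ := by rw [le_div_iff₀ hρ]; linarith
    have h3 : (N : ℝ) = ⌊D / ρ⌋₊ + 1 := by simp [N]
    rw [h3, add_mul, mul_one_div]
    linarith
  refine ⟨Fintype.card (κ × (ι → Fin (N + 1))),
    coveredBy_card (fun s => F s.1 (gridPoint R N s.2)) fun x hx => ?_, ?_⟩
  · obtain ⟨c, t, ht, rfl⟩ := Set.mem_iUnion.1 hx
    obtain ⟨g, hg⟩ := exists_gridPoint_close hR hN ht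
    refine ⟨(c, g), lt_of_le_of_lt ?_ hDN⟩
    have h := frobenius_norm_le (F c t - F c (gridPoint R N g)) (δ := L * (2 * R / N))
      (by positivity) fun i j => (hK c t ht _ (gridPoint_mem_Icc hR hN g) i j).trans
        (mul_le_mul (hKL c) hg dist_nonneg hL0)
    refine h.trans_eq ?_
    simp only [D]
    ring
  · simp only [Fintype.card_prod, Fintype.card_fun, Fintype.card_fin]
    push_cast
    calc (Fintype.card κ : ℝ) * ((N : ℝ) + 1) ^ Fintype.card ι
        ≤ (Fintype.card κ + 1) * ((D + 2) * (1 / ρ)) ^ Fintype.card ι := by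
          gcongr
          linarith
      _ = _ := by rw [mul_pow, mul_assoc]

theorem hasMinkowskiDim_cubeImages {ι κ : Type*} [Fintype ι] [Fintype κ] {m n : ℕ}
    {F : κ → (ι → ℝ) → Matrix (Fin m) (Fin n) ℝ}
    (hF : ∀ c, @ContDiff ℝ _ (ι → ℝ) _ _ (Fin m → Fin n → ℝ) _ _ 1 (F c)) {R : ℝ} (hR : 0 < R)
    (e : ι → Fin m × Fin n) (y₀ : ι → ℝ) {δ : ℝ} (hδ : 0 < δ)
    (hS : ∀ y ∈ Metric.ball y₀ δ, ∃ M ∈ cubeImages F R, ∀ i, M (e i).1 (e i).2 = y i) :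
    HasMinkowskiDim (cubeImages F R) (Fintype.card ι) := by
  obtain ⟨C, hC, hcov⟩ := exists_coveredBy_cubeImages hF hR
  refine hasMinkowskiDim_of_bounds (c := δ ^ Fintype.card ι) (by positivity) hC ?_
  filter_upwards [Ioc_mem_nhdsGT (zero_lt_one' ℝ)] with ρ hρ
  obtain ⟨k, hk, hkC⟩ := hcov ρ hρ.1 hρ.2
  constructor
  · rw [← mul_pow, mul_one_div]
    exact hk.coveredBy_coveringNumber.le_card hρ.1 e y₀ hδ hS
  · exact le_trans (by exact_mod_cast coveringNumber_le hk) hkC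

theorem isSupportSet_cubeImages {Ω : Type*} [MeasurableSpace Ω] (P : Measure Ω) {ι κ : Type*}
    [Fintype ι] [Fintype κ] [Nonempty κ] {m n : ℕ}
    {F : κ → (ι → ℝ) → Matrix (Fin m) (Fin n) ℝ}
    (hF : ∀ c, @ContDiff ℝ _ (ι → ℝ) _ _ (Fin m → Fin n → ℝ) _ _ 1 (F c)) {R : ℝ} (hR : 0 < R)
    {X : Ω → Matrix (Fin m) (Fin n) ℝ} {ε : ℝ}
    (hX : 1 - ε ≤ P.real {ω | X ω ∈ cubeImages F R}) : IsSupportSet P X ε (cubeImages F R) := by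
  let f : κ → (ι → ℝ) → Fin m → Fin n → ℝ := F
  have hK : ∀ c, IsCompact (f c '' Set.Icc (fun _ => -R) (fun _ => R)) := fun c =>
    isCompact_Icc.image (hF c).continuous
  refine ⟨?_, ?_, ?_, hX⟩
  · obtain ⟨c⟩ := ‹Nonempty κ›
    exact ⟨F c fun _ => R, Set.mem_iUnion.2 ⟨c, _, ⟨fun _ => by linarith, fun _ => le_rfl⟩, rfl⟩⟩
  -- Compactness bounds the sup norm; the entrywise estimate transfers this to the Frobenius norm.
  · obtain ⟨C, hC⟩ := (isCompact_iUnion hK).isBounded.exists_norm_le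
    refine isBounded_iff_forall_norm_le.2 ⟨(m * n + 1) * |C|, fun M hM => ?_⟩
    refine frobenius_norm_le M (abs_nonneg C) fun i j => ?_
    let M' : Fin m → Fin n → ℝ := M
    have h : ‖M'‖ ≤ C := hC M' hM
    exact ((norm_le_pi_norm (M' i) j).trans (norm_le_pi_norm M' i)).trans
      (h.trans (le_abs_self C))
  · exact MeasurableSet.iUnion fun c => (hK c).measurableSet

end Norm

/-- Continuity from below: the cubes exhaust `ℝ^ι`, so the probabilities tend to 1. -/
theorem eventually_le_measureReal_cubeImages {Ω : Type*} [MeasurableSpace Ω] (P : Measure Ω)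
    [IsProbabilityMeasure P] {ι κ : Type*} [Fintype ι] {m n : ℕ}
    {F : κ → (ι → ℝ) → Matrix (Fin m) (Fin n) ℝ} {X : Ω → Matrix (Fin m) (Fin n) ℝ}
    (hXF : ∀ᵐ ω ∂P, ∃ c t, X ω = F c t) {ε : ℝ} (hε : 0 < ε) :
    ∀ᶠ R : ℕ in atTop, 1 - ε ≤ P.real {ω | X ω ∈ cubeImages F R} := by
  have hmono : Monotone fun R : ℕ => {ω | X ω ∈ cubeImages F R} := by
    intro R R' h ω hω
    obtain ⟨c, t, ht, htX⟩ := Set.mem_iUnion.1 hω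
    have h' : (R : ℝ) ≤ R' := by exact_mod_cast h
    exact Set.mem_iUnion.2 ⟨c, t, ⟨fun i => (neg_le_neg h').trans (ht.1 i),
      fun i => (ht.2 i).trans h'⟩, htX⟩
  have hunion : P (⋃ R : ℕ, {ω | X ω ∈ cubeImages F R}) = 1 := by
    refine (measure_congr (eventuallyEq_univ.2 ?_)).trans measure_univ
    filter_upwards [hXF] with ω hω
    obtain ⟨c, t, hct⟩ := hω
    obtain ⟨R, hR⟩ := exists_nat_ge ‖t‖
    refine Set.mem_iUnion.2 ⟨R, Set.mem_iUnion.2 ⟨c, t, ⟨fun i => ?_, fun i => ?_⟩, hct.symm⟩⟩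
    · exact (abs_le.1 ((norm_le_pi_norm t i).trans hR)).1
    · exact (abs_le.1 ((norm_le_pi_norm t i).trans hR)).2
  have hT := tendsto_measure_iUnion_atTop (μ := P) hmono
  rw [hunion] at hT
  have hT' := (ENNReal.tendsto_toReal ENNReal.one_ne_top).comp hT
  rw [ENNReal.toReal_one] at hT'
  exact (hT'.eventually (lt_mem_nhds (by linarith : 1 - ε < 1))).mono fun R h => h.le

/-! ### Smoothness and a local inverse at the hook entries -/

theorem lowRank_apply {m n r p q : ℕ} (a : Fin r ⊕ Fin p ↪ Fin m) (b : Fin r ⊕ Fin q ↪ Fin n)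
    (t : Params r p q → ℝ) (i : Fin m) (j : Fin n) :
    lowRank a b t i j = ∑ s, spread a (leftFactor t) s i * spread b (rightFactor t) s j := rfl

theorem contDiff_lowRank {m n r p q : ℕ} (a : Fin r ⊕ Fin p ↪ Fin m)
    (b : Fin r ⊕ Fin q ↪ Fin n) :
    @ContDiff ℝ _ (Params r p q → ℝ) _ _ (Fin m → Fin n → ℝ) _ _ 1 (lowRank a b) := by
  have hl : ∀ s c, ContDiff ℝ 1 fun t : Params r p q → ℝ => leftFactor t s c := by
    rintro s (c | c)
    · exact contDiff_const
    · exact contDiff_apply ℝ ℝ _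
  have hr : ∀ s c, ContDiff ℝ 1 fun t : Params r p q → ℝ => rightFactor t s c := fun s c =>
    contDiff_apply ℝ ℝ _
  refine contDiff_pi.2 fun i => contDiff_pi.2 fun j => ?_
  simp only [lowRank_apply, spread_apply]
  refine ContDiff.sum fun s _ => ContDiff.mul (ContDiff.sum fun c _ => ?_)
    (ContDiff.sum fun c _ => ?_)
  · split_ifs
    exacts [hl s c, contDiff_const]
  · split_ifs
    exacts [hr s c, contDiff_const]

/-- The entries of `lowRank a b t` in the first `r` rows and in the first `r` columns. -/
def hookPosition {m n r p q : ℕ} (a : Fin r ⊕ Fin p ↪ Fin m) (b : Fin r ⊕ Fin q ↪ Fin n) :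
    Params r p q → Fin m × Fin n :=
  Sum.elim (fun x => (a (Sum.inl x.1), b x.2)) fun x => (a (Sum.inr x.2), b (Sum.inl x.1))

/-- The entries of a low-rank matrix at the hook positions are arbitrary near those of
`[1 0]ᵀ [1 0]`. -/
theorem exists_ball_hookPosition {m n r p q : ℕ} (a : Fin r ⊕ Fin p ↪ Fin m)
    (b : Fin r ⊕ Fin q ↪ Fin n) {R : ℝ} (hR : 1 < R) :
    ∃ (y₀ : Params r p q → ℝ) (δ : ℝ), 0 < δ ∧ ∀ y ∈ Metric.ball y₀ δ,
      ∃ t ∈ Set.Icc (fun _ => -R) (fun _ => R), ∀ x,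
        lowRank a b t (hookPosition a b x).1 (hookPosition a b x).2 = y x := by
  let U (y : Params r p q → ℝ) : Matrix (Fin r) (Fin r) ℝ :=
    Matrix.of fun s s' => y (Sum.inl (s, Sum.inl s'))
  let V (y : Params r p q → ℝ) : Matrix (Fin r) (Fin p) ℝ :=
    Matrix.of fun s c => y (Sum.inr (s, c))
  -- The first rows show the right factor itself. The remaining hook entries satisfy `Uᵀ A = V`,
  -- with `A` the free block of the left factor, so `A = (Uᵀ)⁻¹ V`.
  let ψ (y : Params r p q → ℝ) : Params r p q → ℝ :=
    Sum.elim (fun x => y (Sum.inl x)) fun x => (((U y)ᵀ)⁻¹ * V y) x.1 x.2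
  let y₀ : Params r p q → ℝ :=
    Sum.elim (fun x => if Sum.inl x.1 = x.2 then 1 else 0) fun _ => 0
  have hU₀ : U y₀ = 1 := by
    ext s s'
    simp [U, y₀, Matrix.one_apply]
  have hV₀ : V y₀ = 0 := by
    ext s c
    simp [V, y₀]
  have hψ₀ : ψ y₀ = y₀ := by
    ext x
    rcases x with x | x
    · rfl
    · simp only [ψ, Sum.elim_inr, hV₀, Matrix.mul_zero, Matrix.zero_apply, y₀]
  have hUc : Continuous U := continuous_matrix fun s s' => continuous_apply _
  have hVc : Continuous V := continuous_matrix fun s s' => continuous_apply _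
  have hdet : ∀ᶠ y in 𝓝 y₀, (U y).det ≠ 0 := by
    refine hUc.matrix_det.continuousAt.eventually_ne ?_
    simp [hU₀]
  have hψc : ContinuousAt ψ y₀ := by
    refine continuousAt_pi.2 fun x => ?_
    rcases x with x | x
    · exact (continuous_apply _).continuousAt
    · have hadj : Continuous fun y => ((U y)ᵀ).adjugate := hUc.matrix_transpose.matrix_adjugate
      have hdet₀ : ((U y₀)ᵀ).det ≠ 0 := by simp [hU₀]
      simp only [ψ, Sum.elim_inr, Matrix.mul_apply, Matrix.inv_def, Ring.inverse_eq_inv',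
        Matrix.smul_apply, smul_eq_mul]
      refine tendsto_finsetSum _ fun s _ => ContinuousAt.mul (ContinuousAt.mul ?_ ?_) ?_
      · exact hUc.matrix_transpose.matrix_det.continuousAt.inv₀ hdet₀
      · exact (hadj.matrix_elem x.1 s).continuousAt
      · exact (hVc.matrix_elem s x.2).continuousAt
  -- At the fixed point `y₀` of `ψ` all coordinates are 0 or 1, strictly inside the cube as `R > 1`;
  -- continuity keeps nearby values inside.
  have hbox : ∀ᶠ y in 𝓝 y₀, ∀ x, |ψ y x| < R := by
    refine eventually_all.2 fun x => ?_
    have h : |ψ y₀ x| < R := by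
      rw [hψ₀]
      rcases x with x | x
      · simp only [y₀, Sum.elim_inl]
        split_ifs <;> simp <;> linarith
      · simp only [y₀, Sum.elim_inr, abs_zero]
        linarith
    exact ((continuousAt_pi.1 hψc x).abs).eventually (gt_mem_nhds h)
  obtain ⟨δ, hδ, hball⟩ := Metric.eventually_nhds_iff_ball.1 (hdet.and hbox)
  refine ⟨y₀, δ, hδ, fun y hy => ⟨ψ y, ⟨fun x => ?_, fun x => ?_⟩, fun x => ?_⟩⟩
  · exact (abs_lt.1 ((hball y hy).2 x)).1.le
  · exact (abs_lt.1 ((hball y hy).2 x)).2.le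
  · rcases x with ⟨s, c⟩ | ⟨s, c⟩
    · simp [hookPosition, lowRank_apply, leftFactor, rightFactor, ψ, Matrix.one_apply]
    · have h : (U y)ᵀ * (((U y)ᵀ)⁻¹ * V y) = V y := by
        rw [← Matrix.mul_assoc, Matrix.mul_nonsing_inv, Matrix.one_mul]
        rw [Matrix.det_transpose]
        exact isUnit_iff_ne_zero.2 (hball y hy).1
      have h' := congrFun (congrFun h s) c
      rw [Matrix.mul_apply] at h'
      simp only [hookPosition, Sum.elim_inr, lowRank_apply, spread_apply_embedding]
      refine Eq.trans (Finset.sum_congr rfl fun s' _ => ?_) h'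
      simp only [leftFactor, Matrix.fromCols_apply_inr, Matrix.of_apply, rightFactor, ψ,
        Sum.elim_inl, Sum.elim_inr, Matrix.transpose_apply, U]
      exact mul_comm _ _

theorem card_params (r p q : ℕ) : Fintype.card (Params r p q) = r * (r + q) + r * p := by
  simp

end MatrixCompletion

/-! ### The main theorem -/

theorem mainTheorem5
    {Ω : Type*} [MeasurableSpace Ω] (P : Measure Ω) [IsProbabilityMeasure P]
    (m n r l₁ l₂ : ℕ) (hr : 1 ≤ r)
    (hrl₁ : r ≤ l₁) (hl₁ : (l₁ : ℝ) < m / 2)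
    (hrl₂ : r ≤ l₂) (hl₂ : (l₂ : ℝ) ≤ n / 2 - 1 / r)
    (μ₁ μ₂ : ℝ) (v₁ v₂ : ℝ≥0) (hv₁ : v₁ ≠ 0) (hv₂ : v₂ ≠ 0)
    (X₁ : Ω → Matrix (Fin r) (Fin m) ℝ) (X₂ : Ω → Matrix (Fin r) (Fin n) ℝ)
    (hX₁ : HasLaw X₁ (sparseColumnGaussian r m l₁ μ₁ v₁) P)
    (hX₂ : HasLaw X₂ (sparseColumnGaussian r n l₂ μ₂ v₂) P)
    (hindep : IndepFun X₁ X₂ P)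
    (X : Ω → Matrix (Fin m) (Fin n) ℝ) (hX : ∀ ω, X ω = (X₁ ω)ᵀ * X₂ ω) :
    (∀ᵐ ω ∂P, (X ω).rank = r) ∧
    ((l₁ + l₂ : ℝ) * r < (m + n - r : ℝ) * r - 1) ∧
    ∀ ε : ℝ, 0 < ε →
      (∃ T : Set (Matrix (Fin m) (Fin n) ℝ), IsSupportSet P X ε T ∧
        ∃ d : ℝ, HasMinkowskiDim T d ∧ d ≤ (l₁ + l₂ : ℝ) * r) ∧
      (∀ k : ℕ, (l₁ + l₂) * r < k → RecoverableFrom P X ε k) ∧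
      (∃ k : ℕ, (k : ℝ) < (m + n - r : ℝ) * r ∧ RecoverableFrom P X ε k) := by
  have hcount := dimension_count hr hrl₁ hl₁ hrl₂ hl₂
  have hm : l₁ ≤ m := by
    have h : (l₁ : ℝ) ≤ m := by linarith [(Nat.cast_nonneg m : (0 : ℝ) ≤ m)]
    exact_mod_cast h
  have hn : l₂ ≤ n := by
    have h : (0 : ℝ) ≤ 1 / r := by positivity
    have h' : (l₂ : ℝ) ≤ n := by linarith [(Nat.cast_nonneg n : (0 : ℝ) ≤ n)]
    exact_mod_cast h'
  obtain ⟨p, rfl⟩ := Nat.exists_eq_add_of_le hrl₁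
  obtain ⟨q, rfl⟩ := Nat.exists_eq_add_of_le hrl₂
  have hXmeas : AEMeasurable X P := by
    have h : ∀ i j, AEMeasurable (fun ω => X ω i j) P := by
      intro i j
      simp only [hX, Matrix.mul_apply, Matrix.transpose_apply]
      refine Finset.aemeasurable_fun_sum _ fun s _ => ?_
      exact ((measurable_pi_apply i).comp (measurable_pi_apply s)).comp_aemeasurable
        hX₁.aemeasurable |>.mul (((measurable_pi_apply j).comp
          (measurable_pi_apply s)).comp_aemeasurable hX₂.aemeasurable)
    exact aemeasurable_pi_iff.2 fun i => aemeasurable_pi_iff.2 fun j => h i j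
  have h₁ := ae_of_ae_map hX₁.aemeasurable
    (hX₁.map_eq.symm ▸ ae_sparseColumnGaussian r m p μ₁ hv₁)
  have h₂ := ae_of_ae_map hX₂.aemeasurable
    (hX₂.map_eq.symm ▸ ae_sparseColumnGaussian r n q μ₂ hv₂)
  let F (c : (Fin r ⊕ Fin p ↪ Fin m) × (Fin r ⊕ Fin q ↪ Fin n)) :
    (Params r p q → ℝ) → Matrix (Fin m) (Fin n) ℝ := lowRank c.1 c.2
  have hF : ∀ c, @ContDiff ℝ _ (Params r p q → ℝ) _ _ (Fin m → Fin n → ℝ) _ _ 1 (F c) :=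
    fun c => contDiff_lowRank c.1 c.2
  have hXF : ∀ᵐ ω ∂P, ∃ c t, X ω = F c t := by
    filter_upwards [h₁, h₂] with ω hω₁ hω₂
    obtain ⟨a, M, hM, hMu⟩ := hω₁
    obtain ⟨b, N, hN, -⟩ := hω₂
    obtain ⟨t, ht⟩ := exists_lowRank_eq a b M N hMu
    exact ⟨(a, b), t, by rw [hX, hM, hN, ht]⟩
  -- The left side is smaller by exactly `r²`.
  have hcard : Fintype.card (Params r p q) ≤ (r + p + (r + q)) * r := by
    rw [card_params]
    nlinarith [Nat.zero_le (r * r)]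
  have hrec : ∀ ε : ℝ, 0 < ε → ∀ k : ℕ, (r + p + (r + q)) * r < k → RecoverableFrom P X ε k :=
    fun ε hε k hk =>
      recoverableFrom_of_ae_mem_range P (hcard.trans_lt hk) hF hXmeas hXF hε.le
  refine ⟨?_, hcount, fun ε hε => ⟨?_, hrec ε hε, (r + p + (r + q)) * r + 1, ?_,
    hrec ε hε _ (Nat.lt_succ_self _)⟩⟩
  · filter_upwards [h₁, h₂] with ω hω₁ hω₂
    obtain ⟨a, M, hM, hMu⟩ := hω₁
    obtain ⟨b, N, hN, hNu⟩ := hω₂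
    rw [hX, hM, hN]
    exact rank_spread_mul_spread a b M N hMu hNu
  -- One choice of positions suffices for the lower bound on covering numbers; the initial columns
  -- are taken.
  · let a : Fin r ⊕ Fin p ↪ Fin m := finSumFinEquiv.toEmbedding.trans (Fin.castLEEmb hm)
    let b : Fin r ⊕ Fin q ↪ Fin n := finSumFinEquiv.toEmbedding.trans (Fin.castLEEmb hn)
    have : Nonempty ((Fin r ⊕ Fin p ↪ Fin m) × (Fin r ⊕ Fin q ↪ Fin n)) := ⟨(a, b)⟩
    obtain ⟨R, hR, hR1⟩ := ((eventually_le_measureReal_cubeImages P hXF hε).and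
      (eventually_gt_atTop 1)).exists
    have hR' : (1 : ℝ) < R := by exact_mod_cast hR1
    obtain ⟨y₀, δ, hδ, hball⟩ := exists_ball_hookPosition a b hR'
    refine ⟨cubeImages F R, isSupportSet_cubeImages P hF (zero_lt_one.trans hR') hR,
      Fintype.card (Params r p q), ?_, by exact_mod_cast hcard⟩
    refine hasMinkowskiDim_cubeImages hF (zero_lt_one.trans hR') (hookPosition a b) y₀ hδ ?_
    intro y hy
    obtain ⟨t, ht, hty⟩ := hball y hy
    exact ⟨_, Set.mem_iUnion.2 ⟨(a, b), t, ht, rfl⟩, hty⟩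
  · push_cast at hcount ⊢
    linarith
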